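/- Let $\mathcal A$ be the collection of all geometric squares $\{a,ar,as,ars\}$ with $a,r,s$ positive integers and $1<r<s$. For a finite set $X$ of positive integers let $G_{\mathcal A}(X)$ be the largest size of a subset of $X$ that contains no member of $\mathcal A$. Let $p_1<p_2<\cdots$ be the primes, let $P_d=p_1p_2\cdots p_d$, let $a_d=\{\prod_{i=1}^d p_i^{e_i}: e_i\in\{0,1\}\}$, and let $\varphi$ be Euler's function. Let $c_{d,2,2}$ be the largest size of a family of subsets of $[d]=\{1,\dots,d\}$ that contains no subfamily which is a sublattice of the power set of $[d]$ (under $\cup$ and $\cap$) isomorphic to the power set of a two-element set; that is, the family does not contain four distinct sets of the form $A,\ B,\ A\cap B,\ A\cup B$. Then $G_{\mathcal A}(a_d)=c_{d,2,2}$ for every $d\ge 0$, and $$c_{0,2,2}=1,\quad c_{1,2,2}=2,\quad c_{2,2,2}=3,\quad c_{3,2,2}=6,\quad c_{4,2,2}=11,\quad c_{5,2,2}=21.$$ Moreover, the series below converges, and $$\frac56\le\limsup_{n\to\infty}\frac{G_{\mathcal A}([n])}{n}\le 1-\frac43\sum_{d=1}^{\infty}\bigl(2c_{d-1,2,2}-c_{d,2,2}\bigr)\frac{\varphi(P_d)}{P_d^2}<\frac{3699337}{4002075}.$$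 -/

import Mathlib

open Filter

/-- `A` has no subset belonging to the collection `𝒜` of proscribed sets. -/
def Avoids (𝒜 : Set (Set ℕ)) (A : Finset ℕ) : Prop :=
  ∀ B ∈ 𝒜, ¬ B ⊆ (A : Set ℕ)

open Classical in
/-- `G_𝒜(X)`: the maximum cardinality of a subset of the finite set `X` that has no subset
belonging to `𝒜`. -/
noncomputable def maxAvoid (𝒜 : Set (Set ℕ)) (X : Finset ℕ) : ℕ :=
  (X.powerset.filter (Avoids 𝒜)).sup Finset.card

/-- The geometric squares `{a, ar, as, ars}` with `a, r, s` positive integers and `1 < r < s`. -/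
def geometricSquares : Set (Set ℕ) :=
  {B | ∃ a r s : ℕ, 1 ≤ a ∧ 1 < r ∧ r < s ∧ B = {a, a * r, a * s, a * r * s}}

/-- `P_d`, the product of the first `d` primes (`Nat.nth Nat.Prime` is indexed from `0`). -/
noncomputable def primorialFirst (d : ℕ) : ℕ :=
  ∏ i : Fin d, Nat.nth Nat.Prime i

/-- `a_d = {∏_{i ≤ d} p_i ^ e_i : 0 ≤ e_i ≤ 1}`, where `p_1 < p_2 < ⋯` are the primes. -/
noncomputable def primeCube (d : ℕ) : Finset ℕ :=
  Finset.univ.image fun e : Fin d → Fin 2 => ∏ i : Fin d, Nat.nth Nat.Prime i ^ (e i : ℕ)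

/-- The family `F` of subsets of `[d]` contains a subfamily that, as a sublattice of the power set
of `[d]` (with operations union and intersection), is isomorphic to the power set of `[s]`. -/
def ContainsBooleanLattice {d : ℕ} (s : ℕ) (F : Finset (Finset (Fin d))) : Prop :=
  ∃ f : LatticeHom (Finset (Fin s)) (Finset (Fin d)), Function.Injective f ∧ ∀ T, f T ∈ F

open Classical in
/-- The generalized Sperner number `c_{d,s,2}`: the maximum cardinality of a family of subsets of
`[d]` that contains no subfamily lattice isomorphic to the power set of `[s]`. -/
noncomputable def genSperner (d s : ℕ) : ℕ :=
  (Finset.univ.filter fun F : Finset (Finset (Fin d)) => ¬ ContainsBooleanLattice s F).sup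
    Finset.card

/-!
Four sets `A`, `B`, `A ∩ B`, `A ∪ B` with `A`, `B` incomparable form a diamond, which is the same as
a sublattice isomorphic to the power set of a two-element set. If `P` is squarefree and `0 < x`,
then `t ↦ t.primeFactors` identifies `x * P.divisors` with the power set of `P.primeFactors` and
turns geometric squares into diamonds, since `gcd` and `lcm` become `∩` and `∪`. Hence a set
avoiding geometric squares meets each such dilate in at most `c_{ω(P),2,2}` points, and the bound is
attained.

*Sperner numbers.* For a diamond-free family `F` and a point `a`, the sets `S` with `a ∉ S` and both
`S` and `insert a S` in `F` form an antichain, so Sperner's theorem gives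
`c_{n+1,2,2} ≤ 2 ^ n + n.choose (n / 2)`. For even `n = 2k ≥ 4` equality is impossible: by the
equality case of the LYM inequality it would hold for every `a` at once, forcing `F` to contain
all sets of sizes `k - 2`, `k`, `k + 1` and `k + 3`, among which there is a diamond.
Unions of suitable layers give the matching lower bounds for `n ≤ 5`.

*Upper density.* Let `A ⊆ [n]` avoid geometric squares, let `P_d` be the product of the first `d`
primes and `p` the next one. The dilate of `P_{d+1}.divisors` by `x` is the disjoint union of the
dilates of `P_d.divisors` by `x` and `p * x`, so the amounts by which `A` misses the bound on the
latter two add up to its miss on the former plus `2 c_{d,2,2} - c_{d+1,2,2}`. If `x` runs over the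
numbers `4 ^ j * b ≤ n / P_{d+1}` with `b` coprime to `P_{d+1}`, then all the points `x` and `p * x`
are distinct and of the same kind for `P_d`. The total miss for `d = 0` is `n - |A|`, so telescoping
bounds this below by the sum of `2 c_{d,2,2} - c_{d+1,2,2}` times the number of such `x`, which is
asymptotically `4 / 3 * φ(P_{d+1}) / P_{d+1} ^ 2 * n`, the factor `4 / 3` being `∑ j, 4 ^ (-j)`.
-/

section Diamond

variable {L M : Type*} [Lattice L] [Lattice M]

/-- A diamond in `F` is a pair of incomparable members whose infimum and supremum also belong to
`F`: a copy in `F` of the Boolean lattice on two atoms. -/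
def HasDiamond (F : Set L) : Prop :=
  ∃ a b, ¬ a ≤ b ∧ ¬ b ≤ a ∧ a ∈ F ∧ b ∈ F ∧ a ⊓ b ∈ F ∧ a ⊔ b ∈ F

theorem HasDiamond.mono {F G : Set L} (hFG : F ⊆ G) : HasDiamond F → HasDiamond G
  | ⟨a, b, hab, hba, ha, hb, hinf, hsup⟩ =>
    ⟨a, b, hab, hba, hFG ha, hFG hb, hFG hinf, hFG hsup⟩

theorem HasDiamond.image {f : L → M} {F : Set L} (hinf : ∀ a b, f (a ⊓ b) = f a ⊓ f b)
    (hsup : ∀ a b, f (a ⊔ b) = f a ⊔ f b) (hf : F.InjOn f) :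
    HasDiamond F → HasDiamond (f '' F) := by
  rintro ⟨a, b, hab, hba, ha, hb, hi, hs⟩
  refine ⟨f a, f b, fun h => hab ?_, fun h => hba ?_, Set.mem_image_of_mem f ha,
    Set.mem_image_of_mem f hb, hinf a b ▸ Set.mem_image_of_mem f hi,
    hsup a b ▸ Set.mem_image_of_mem f hs⟩
  · exact inf_eq_left.1 (hf hi ha (by rw [hinf, inf_eq_left.2 h]))
  · exact inf_eq_right.1 (hf hi hb (by rw [hinf, inf_eq_right.2 h]))

theorem HasDiamond.of_image {f : L → M} {F : Set L} (hinf : ∀ a b, f (a ⊓ b) = f a ⊓ f b)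
    (hsup : ∀ a b, f (a ⊔ b) = f a ⊔ f b) (hf : Function.Injective f) :
    HasDiamond (f '' F) → HasDiamond F := by
  rintro ⟨_, _, hab, hba, ⟨a, ha, rfl⟩, ⟨b, hb, rfl⟩, hi, hs⟩
  rw [← hinf, hf.mem_set_image] at hi
  rw [← hsup, hf.mem_set_image] at hs
  refine ⟨a, b, fun h => hab ?_, fun h => hba ?_, ha, hb, hi, hs⟩
  · rw [← inf_eq_left, ← hinf, inf_eq_left.2 h]
  · rw [← inf_eq_right, ← hinf, inf_eq_right.2 h]

/-- The homomorphism from the Boolean lattice on two atoms sending the atoms to `a` and `b`, the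
bottom to `a ⊓ b` and the top to `a ⊔ b`. -/
def diamondHom (a b : L) : LatticeHom (Finset (Fin 2)) L where
  toFun T := if 0 ∈ T then if 1 ∈ T then a ⊔ b else a else if 1 ∈ T then b else a ⊓ b
  map_sup' S T := by
    by_cases h0 : 0 ∈ S <;> by_cases h1 : 1 ∈ S <;> by_cases h2 : 0 ∈ T <;> by_cases h3 : 1 ∈ T <;>
      simp [h0, h1, h2, h3, sup_comm, inf_le_of_left_le]
  map_inf' S T := by
    by_cases h0 : 0 ∈ S <;> by_cases h1 : 1 ∈ S <;> by_cases h2 : 0 ∈ T <;> by_cases h3 : 1 ∈ T <;>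
      simp [h0, h1, h2, h3, inf_comm]

theorem diamondHom_injective {a b : L} (hab : ¬ a ≤ b) (hba : ¬ b ≤ a) :
    Function.Injective (diamondHom a b) := by
  have mem_zero (T) : 0 ∈ T ↔ a ≤ diamondHom a b T := by
    by_cases h0 : 0 ∈ T <;> by_cases h1 : 1 ∈ T <;> simp [diamondHom, h0, h1, hab]
  have mem_one (T) : 1 ∈ T ↔ b ≤ diamondHom a b T := by
    by_cases h0 : 0 ∈ T <;> by_cases h1 : 1 ∈ T <;> simp [diamondHom, h0, h1, hba]
  intro S T h
  ext i
  fin_cases i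
  · simp [mem_zero, h]
  · simp [mem_one, h]

theorem exists_injective_latticeHom_iff_hasDiamond {F : Set L} :
    (∃ f : LatticeHom (Finset (Fin 2)) L, Function.Injective f ∧ ∀ T, f T ∈ F) ↔
      HasDiamond F := by
  constructor
  · rintro ⟨f, hf, hF⟩
    have hdiamond : HasDiamond (Set.univ : Set (Finset (Fin 2))) :=
      ⟨{0}, {1}, by decide, by decide, trivial, trivial, trivial, trivial⟩
    exact (hdiamond.image (map_inf f) (map_sup f) hf.injOn).mono
      (Set.image_subset_iff.2 fun T _ => hF T)
  · rintro ⟨a, b, hab, hba, ha, hb, hinf, hsup⟩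
    refine ⟨diamondHom a b, diamondHom_injective hab hba, fun T => ?_⟩
    by_cases h0 : 0 ∈ T <;> by_cases h1 : 1 ∈ T <;> simpa [diamondHom, h0, h1]

end Diamond

section Antichain

variable {α : Type*} {V : Finset α} {F : Finset (Finset α)}

theorem exists_eq_image_map [DecidableEq α] {β : Type*} [Fintype β] (e : β ↪ α)
    (hF : F ⊆ (Finset.univ.map e).powerset) :
    ∃ G : Finset (Finset β), F = G.image (Finset.map e) := by
  refine ⟨Finset.univ.filter fun S => S.map e ∈ F, Finset.Subset.antisymm (fun S hS => ?_)
    (Finset.image_subset_iff.2 fun S hS => (Finset.mem_filter.1 hS).2)⟩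
  obtain ⟨T, -, rfl⟩ := Finset.subset_map_iff.1 (Finset.mem_powerset.1 (hF hS))
  exact Finset.mem_image_of_mem _ (Finset.mem_filter.2 ⟨Finset.mem_univ T, hS⟩)

theorem exists_map_univ_eq (V : Finset α) : ∃ e : Fin V.card ↪ α, Finset.univ.map e = V :=
  ⟨V.equivFin.symm.toEmbedding.trans (Function.Embedding.subtype _), by
    rw [← Finset.map_map, Finset.map_univ_equiv]
    exact Finset.attach_map_val⟩

theorem sum_inv_choose_le_one_of_isAntichain (hFV : F ⊆ V.powerset)
    (hF : IsAntichain (· ⊆ ·) (F : Set (Finset α))) :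
    ∑ S ∈ F, ((V.card.choose S.card : ℚ))⁻¹ ≤ 1 := by
  classical
  obtain ⟨e, he⟩ := exists_map_univ_eq V
  obtain ⟨G, rfl⟩ := exists_eq_image_map e (he ▸ hFV)
  have hG : IsAntichain (· ⊆ ·) (G : Set (Finset (Fin V.card))) := fun S hS T hT hne h =>
    hF (Finset.mem_image_of_mem _ hS) (Finset.mem_image_of_mem _ hT)
      ((Finset.map_injective e).ne hne) (Finset.map_subset_map.2 h)
  simpa [Finset.sum_image (Finset.map_injective e).injOn] using
    Finset.lubell_yamamoto_meshalkin_inequality_sum_inv_choose (𝕜 := ℚ) hG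

theorem card_le_choose_half_of_isAntichain (hFV : F ⊆ V.powerset)
    (hF : IsAntichain (· ⊆ ·) (F : Set (Finset α))) :
    F.card ≤ V.card.choose (V.card / 2) := by
  have hmid : (0 : ℚ) < V.card.choose (V.card / 2) := by
    exact_mod_cast Nat.choose_pos (Nat.div_le_self _ 2)
  have hsum : F.card • ((V.card.choose (V.card / 2) : ℚ))⁻¹ ≤ 1 :=
    (Finset.card_nsmul_le_sum F _ _ fun S hS => inv_anti₀
      (by exact_mod_cast Nat.choose_pos (Finset.card_le_card (Finset.mem_powerset.1 (hFV hS))))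
      (by exact_mod_cast Nat.choose_le_middle _ _)).trans
        (sum_inv_choose_le_one_of_isAntichain hFV hF)
  rw [nsmul_eq_mul, ← div_eq_mul_inv, div_le_one hmid] at hsum
  exact_mod_cast hsum

theorem choose_lt_choose_half {k j : ℕ} (hj : j ≠ k) : (2 * k).choose j < (2 * k).choose k := by
  have below {i : ℕ} (hi : i < k) : (2 * k).choose i < (2 * k).choose k := by
    have hstep := Nat.choose_succ_right_eq (2 * k) i
    have hpos : 0 < (2 * k).choose i := Nat.choose_pos (by omega)
    have hle : (2 * k).choose (i + 1) ≤ (2 * k).choose k := by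
      simpa using Nat.choose_le_middle (i + 1) (2 * k)
    have : i + 1 < 2 * k - i := by omega
    nlinarith
  rcases hj.lt_or_gt with hj | hj
  · exact below hj
  · rcases le_or_gt j (2 * k) with hle | hgt
    · rw [← Nat.choose_symm hle]
      exact below (by omega)
    · rw [Nat.choose_eq_zero_of_lt hgt]
      exact Nat.choose_pos (by omega)

theorem card_lt_choose_half_of_isAntichain {k : ℕ} (hV : V.card = 2 * k) (hFV : F ⊆ V.powerset)
    (hF : IsAntichain (· ⊆ ·) (F : Set (Finset α))) (hne : ∃ S ∈ F, S.card ≠ k) :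
    F.card < (2 * k).choose k := by
  obtain ⟨S, hS, hSk⟩ := hne
  have hpos {T} (hT : T ∈ F) : (0 : ℚ) < (2 * k).choose T.card := by
    exact_mod_cast Nat.choose_pos (hV ▸ Finset.card_le_card (Finset.mem_powerset.1 (hFV hT)))
  have hmid : (0 : ℚ) < (2 * k).choose k := by exact_mod_cast Nat.choose_pos (by omega)
  have hlym := sum_inv_choose_le_one_of_isAntichain hFV hF
  rw [hV] at hlym
  have hsum : ∑ _T ∈ F, ((2 * k).choose k : ℚ)⁻¹ < 1 := by
    refine (Finset.sum_lt_sum (fun T hT => inv_anti₀ (hpos hT) ?_) ⟨S, hS, ?_⟩).trans_le hlym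
    · simpa using Nat.choose_le_middle T.card (2 * k)
    · exact inv_strictAnti₀ (hpos hS) (by exact_mod_cast choose_lt_choose_half hSk)
  rw [Finset.sum_const, nsmul_eq_mul, ← div_eq_mul_inv, div_lt_one hmid] at hsum
  exact_mod_cast hsum

end Antichain

section GenSperner

variable {α : Type*} [DecidableEq α] {V : Finset α} {F : Finset (Finset α)} {n : ℕ}

theorem containsBooleanLattice_two_iff {d : ℕ} {F : Finset (Finset (Fin d))} :
    ContainsBooleanLattice 2 F ↔ HasDiamond (F : Set (Finset (Fin d))) :=
  exists_injective_latticeHom_iff_hasDiamond (F := (F : Set (Finset (Fin d))))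

theorem genSperner_two_le {d : ℕ} (h : ∀ F : Finset (Finset (Fin d)),
    ¬ HasDiamond (F : Set (Finset (Fin d))) → F.card ≤ n) : genSperner d 2 ≤ n := by
  classical
  refine Finset.sup_le fun F hF => h F ?_
  simpa only [Finset.mem_filter, Finset.mem_univ, true_and, containsBooleanLattice_two_iff] using hF

theorem hasDiamond_image_map_iff {β : Type*} [DecidableEq β] (e : β ↪ α) (G : Finset (Finset β)) :
    HasDiamond (G.image (Finset.map e) : Set (Finset α)) ↔ HasDiamond (G : Set (Finset β)) := by
  rw [Finset.coe_image]
  have hinf (S T : Finset β) : (S ⊓ T).map e = S.map e ⊓ T.map e := Finset.map_inter S T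
  have hsup (S T : Finset β) : (S ⊔ T).map e = S.map e ⊔ T.map e := Finset.map_union S T
  exact ⟨.of_image hinf hsup (Finset.map_injective e),
    .image hinf hsup (Finset.map_injective e).injOn⟩

theorem card_le_genSperner_two (hFV : F ⊆ V.powerset) (hF : ¬ HasDiamond (F : Set (Finset α))) :
    F.card ≤ genSperner V.card 2 := by
  classical
  obtain ⟨e, he⟩ := exists_map_univ_eq V
  obtain ⟨G, rfl⟩ := exists_eq_image_map e (he ▸ hFV)
  rw [Finset.card_image_of_injective _ (Finset.map_injective e)]
  refine Finset.le_sup (f := Finset.card) ?_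
  rw [hasDiamond_image_map_iff] at hF
  simpa only [Finset.mem_filter, Finset.mem_univ, true_and, containsBooleanLattice_two_iff]

theorem exists_card_eq_genSperner_two (V : Finset α) : ∃ F ⊆ V.powerset,
    ¬ HasDiamond (F : Set (Finset α)) ∧ F.card = genSperner V.card 2 := by
  classical
  obtain ⟨G, hG, hcard⟩ := Finset.exists_mem_eq_sup
    (Finset.univ.filter fun F : Finset (Finset (Fin V.card)) => ¬ ContainsBooleanLattice 2 F)
    ⟨∅, by simp [containsBooleanLattice_two_iff, HasDiamond]⟩ Finset.card
  simp only [Finset.mem_filter, Finset.mem_univ, true_and, containsBooleanLattice_two_iff] at hG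
  obtain ⟨e, he⟩ := exists_map_univ_eq V
  refine ⟨G.image (Finset.map e), fun S hS => ?_, by rwa [hasDiamond_image_map_iff], ?_⟩
  · obtain ⟨T, -, rfl⟩ := Finset.mem_image.1 hS
    exact Finset.mem_powerset.2 ((Finset.map_subset_map.2 T.subset_univ).trans he.subset)
  · rw [Finset.card_image_of_injective _ (Finset.map_injective e)]
    unfold genSperner
    convert hcard.symm

theorem not_hasDiamond_nonMemberSubfamily (a : α) (hF : ¬ HasDiamond (F : Set (Finset α))) :
    ¬ HasDiamond (F.nonMemberSubfamily a : Set (Finset α)) :=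
  mt (HasDiamond.mono (Finset.coe_subset.2 (Finset.filter_subset _ _))) hF

theorem not_hasDiamond_memberSubfamily (a : α) (hF : ¬ HasDiamond (F : Set (Finset α))) :
    ¬ HasDiamond (F.memberSubfamily a : Set (Finset α)) := by
  refine fun h => hF ((h.image (Finset.insert_inter_distrib · · a)
    (Finset.insert_union_distrib a) ?_).mono ?_)
  · intro S hS T hT h
    rw [← Finset.erase_insert (Finset.mem_memberSubfamily.1 hS).2,
      ← Finset.erase_insert (Finset.mem_memberSubfamily.1 hT).2]
    exact congrArg (Finset.erase · a) h
  · exact Set.image_subset_iff.2 fun S hS => (Finset.mem_memberSubfamily.1 hS).1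

theorem isAntichain_subfamily_inter (a : α) (hF : ¬ HasDiamond (F : Set (Finset α))) :
    IsAntichain (· ⊆ ·)
      (F.memberSubfamily a ∩ F.nonMemberSubfamily a : Set (Finset α)) := by
  intro S hS T hT hne hST
  simp only [Set.mem_inter_iff, Finset.mem_coe, Finset.mem_memberSubfamily,
    Finset.mem_nonMemberSubfamily] at hS hT
  obtain ⟨⟨hinsS, -⟩, hS, -⟩ := hS
  obtain ⟨⟨hinsT, haT⟩, hT, -⟩ := hT
  refine hF ⟨T, insert a S, fun h => hne (hST.antisymm ?_), fun h => haT (h (by simp)), hT, hinsS,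
    ?_, ?_⟩
  · exact (Finset.subset_insert_iff_of_notMem haT).1 h
  · rwa [Finset.inf_eq_inter, Finset.inter_insert_of_notMem haT, Finset.inter_eq_right.2 hST]
  · rwa [Finset.sup_eq_union, Finset.union_insert, Finset.union_eq_left.2 hST]

theorem memberSubfamily_subset_powerset_erase (a : α) (hFV : F ⊆ V.powerset) :
    F.memberSubfamily a ⊆ (V.erase a).powerset := fun S hS => by
  rw [Finset.mem_memberSubfamily] at hS
  exact Finset.mem_powerset.2 (Finset.subset_erase.2
    ⟨(Finset.subset_insert a S).trans (Finset.mem_powerset.1 (hFV hS.1)), hS.2⟩)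

theorem nonMemberSubfamily_subset_powerset_erase (a : α) (hFV : F ⊆ V.powerset) :
    F.nonMemberSubfamily a ⊆ (V.erase a).powerset := fun S hS => by
  rw [Finset.mem_nonMemberSubfamily] at hS
  exact Finset.mem_powerset.2 (Finset.subset_erase.2 ⟨Finset.mem_powerset.1 (hFV hS.1), hS.2⟩)

theorem card_subfamily_union_add_card_inter (a : α) (F : Finset (Finset α)) :
    (F.memberSubfamily a ∪ F.nonMemberSubfamily a).card +
      (F.memberSubfamily a ∩ F.nonMemberSubfamily a).card = F.card := by
  rw [Finset.card_union_add_card_inter, Finset.card_memberSubfamily_add_card_nonMemberSubfamily]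

theorem genSperner_two_succ_le_two_mul (n : ℕ) : genSperner (n + 1) 2 ≤ 2 * genSperner n 2 := by
  refine genSperner_two_le fun F hF => ?_
  have hFV : F ⊆ Finset.univ.powerset := by simp
  have hcard : (Finset.univ.erase (0 : Fin (n + 1))).card = n := by simp
  have hmem := card_le_genSperner_two (memberSubfamily_subset_powerset_erase 0 hFV)
    (not_hasDiamond_memberSubfamily 0 hF)
  have hnonMem := card_le_genSperner_two (nonMemberSubfamily_subset_powerset_erase 0 hFV)
    (not_hasDiamond_nonMemberSubfamily 0 hF)
  rw [hcard] at hmem hnonMem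
  have := Finset.card_memberSubfamily_add_card_nonMemberSubfamily 0 F
  omega

theorem genSperner_two_succ_le_add_choose (n : ℕ) :
    genSperner (n + 1) 2 ≤ 2 ^ n + n.choose (n / 2) := by
  refine genSperner_two_le fun F hF => ?_
  have hFV : F ⊆ Finset.univ.powerset := by simp
  have hmem := memberSubfamily_subset_powerset_erase 0 hFV
  have hnonMem := nonMemberSubfamily_subset_powerset_erase 0 hFV
  have hunion := Finset.card_le_card (Finset.union_subset hmem hnonMem)
  have hinter := card_le_choose_half_of_isAntichain (Finset.inter_subset_left.trans hmem)
    (by simpa using isAntichain_subfamily_inter 0 hF)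
  rw [← card_subfamily_union_add_card_inter 0 F]
  simpa using add_le_add hunion hinter

theorem subfamily_eq_of_extremal [Fintype α] {k : ℕ} (hα : Fintype.card α = 2 * k + 1)
    (hF : ¬ HasDiamond (F : Set (Finset α))) (hcard : 2 ^ (2 * k) + (2 * k).choose k ≤ F.card)
    (a : α) :
    F.memberSubfamily a ∪ F.nonMemberSubfamily a = (Finset.univ.erase a).powerset ∧
      F.memberSubfamily a ∩ F.nonMemberSubfamily a = (Finset.univ.erase a).powersetCard k := by
  have herase : (Finset.univ.erase a).card = 2 * k := by simp [Finset.card_erase_of_mem, hα]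
  have hFV : F ⊆ Finset.univ.powerset := by simp
  have hunion := Finset.union_subset (memberSubfamily_subset_powerset_erase a hFV)
    (nonMemberSubfamily_subset_powerset_erase a hFV)
  have hinter := (Finset.inter_subset_union (s := F.memberSubfamily a)
    (t := F.nonMemberSubfamily a)).trans hunion
  have hanti : IsAntichain (· ⊆ ·) ((F.memberSubfamily a ∩ F.nonMemberSubfamily a : Finset _) :
      Set (Finset α)) := by simpa using isAntichain_subfamily_inter a hF
  have hcard' := card_subfamily_union_add_card_inter a F
  have hunion_le := Finset.card_le_card hunion
  have hinter_le := card_le_choose_half_of_isAntichain hinter hanti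
  rw [herase, Nat.mul_div_cancel_left k two_pos] at hinter_le
  rw [Finset.card_powerset, herase] at hunion_le
  refine ⟨Finset.eq_of_subset_of_card_le hunion ?_, Finset.eq_of_subset_of_card_le
    (fun S hS => Finset.mem_powersetCard.2 ⟨Finset.mem_powerset.1 (hinter hS), ?_⟩) ?_⟩
  · rw [Finset.card_powerset, herase]
    omega
  · by_contra hSk
    have := card_lt_choose_half_of_isAntichain herase hinter hanti ⟨S, hS, hSk⟩
    omega
  · rw [Finset.card_powersetCard, herase]
    omega

end GenSperner

section StrictBound

variable {α : Type*} [DecidableEq α] {F : Finset (Finset α)} {k : ℕ}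

theorem exists_diamond_of_layers [Fintype α] (hk : 2 ≤ k) (hα : k + 3 ≤ Fintype.card α)
    (hF : ∀ S : Finset α,
      S.card + 2 = k ∨ S.card = k ∨ S.card = k + 1 ∨ S.card = k + 3 → S ∈ F) :
    HasDiamond (F : Set (Finset α)) := by
  obtain ⟨U, -, hU⟩ := Finset.exists_subset_card_eq (s := (Finset.univ : Finset α)) hα
  obtain ⟨A, hAU, hA⟩ := Finset.exists_subset_card_eq (s := U) (n := k) (by omega)
  obtain ⟨C, hCA, hC⟩ := Finset.exists_subset_card_eq (s := A) (n := k - 2) (by omega)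
  have hUA : (U \ A).card = 3 := by rw [Finset.card_sdiff_of_subset hAU]; omega
  have hdisj : Disjoint A (U \ A) := Finset.disjoint_sdiff
  have hinter : A ∩ (C ∪ U \ A) = C := by
    rw [Finset.inter_union_distrib_left, Finset.disjoint_iff_inter_eq_empty.1 hdisj,
      Finset.union_empty, Finset.inter_eq_right.2 hCA]
  have hunion : A ∪ (C ∪ U \ A) = U := by
    rw [← Finset.union_assoc, Finset.union_eq_left.2 hCA, Finset.union_sdiff_of_subset hAU]
  have hB : (C ∪ U \ A).card = k + 1 := by
    rw [Finset.card_union_of_disjoint (hdisj.mono_left hCA)]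
    omega
  refine ⟨A, C ∪ U \ A, fun h => ?_, fun h => ?_, hF _ (by omega), hF _ (by omega),
    hF _ ?_, hF _ ?_⟩
  · have := Finset.card_le_card (Finset.inter_eq_left.2 h ▸ hinter.subset)
    omega
  · have := Finset.card_le_card h
    omega
  · rw [Finset.inf_eq_inter, hinter]
    omega
  · rw [Finset.sup_eq_union, hunion]
    omega

theorem mem_of_card_of_extremal [Fintype α] (hα : Fintype.card α = 2 * k + 1)
    (hF : ¬ HasDiamond (F : Set (Finset α))) (hcard : 2 ^ (2 * k) + (2 * k).choose k ≤ F.card)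
    {S : Finset α} (hS : S.card + 2 = k ∨ S.card = k ∨ S.card = k + 1 ∨ S.card = k + 3) :
    S ∈ F := by
  have mem_or {a} {S} (ha : a ∉ S) : insert a S ∈ F ∨ S ∈ F := by
    have := (Finset.ext_iff.1 (subfamily_eq_of_extremal hα hF hcard a).1 S).2
      (by simp [Finset.subset_erase, ha])
    simpa [ha] using this
  have mem_and_iff {a} {S} (ha : a ∉ S) : insert a S ∈ F ∧ S ∈ F ↔ S.card = k := by
    have := Finset.ext_iff.1 (subfamily_eq_of_extremal hα hF hcard a).2 S
    simpa [Finset.mem_powersetCard, Finset.subset_erase, ha] using this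
  have exists_notMem (S : Finset α) (hS : S.card ≤ k) : ∃ a, a ∉ S := by
    by_contra! h
    have := Finset.card_le_card fun a (_ : a ∈ Finset.univ) => h a
    rw [Finset.card_univ] at this
    omega
  have middle {S} (hS : S.card = k) : S ∈ F :=
    have ⟨_, ha⟩ := exists_notMem S hS.le
    ((mem_and_iff ha).2 hS).2
  have middle_succ {S} (hS : S.card = k + 1) : S ∈ F := by
    obtain ⟨a, T, ha, rfl, hT⟩ := Finset.card_eq_succ.1 hS
    exact ((mem_and_iff ha).2 hT).1
  rcases hS with hS | hS | hS | hS
  · obtain ⟨a, ha⟩ := exists_notMem S (by omega)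
    refine (mem_or ha).resolve_left fun h => ?_
    have hins : (insert a S).card + 1 = k := by rw [Finset.card_insert_of_notMem ha]; omega
    obtain ⟨b, hb⟩ := exists_notMem (insert a S) (by omega)
    have := (mem_and_iff hb).1 ⟨middle (by rw [Finset.card_insert_of_notMem hb, hins]), h⟩
    omega
  · exact middle hS
  · exact middle_succ hS
  · obtain ⟨a, T, ha, rfl, hT⟩ := Finset.card_eq_succ.1 hS
    refine (mem_or ha).resolve_right fun h => ?_
    obtain ⟨b, R, hb, rfl, hR⟩ := Finset.card_eq_succ.1 hT
    have := (mem_and_iff hb).1 ⟨h, middle_succ hR⟩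
    omega

theorem genSperner_two_mul_add_one_lt (hk : 2 ≤ k) :
    genSperner (2 * k + 1) 2 < 2 ^ (2 * k) + (2 * k).choose k := by
  refine Nat.lt_of_le_pred (by positivity) (genSperner_two_le fun F hF => Nat.le_pred_of_lt ?_)
  by_contra! hcard
  exact hF (exists_diamond_of_layers hk (by simp; omega) fun S hS =>
    mem_of_card_of_extremal (by simp) hF hcard hS)

end StrictBound

section Values

theorem sum_choose_le_genSperner_two (d : ℕ) (K : Finset ℕ)
    (hK : ∀ a ∈ K, ∀ b ∈ K, ∀ u ∈ K, ∀ v ∈ K, u < a → u < b → a < v → b < v → a + b ≠ u + v) :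
    ∑ j ∈ K, d.choose j ≤ genSperner d 2 := by
  let V : Finset (Fin d) := Finset.univ
  have hV : V.card = d := by simp [V]
  have hcard : (K.biUnion V.powersetCard).card = ∑ j ∈ K, d.choose j := by
    rw [Finset.card_biUnion fun i _ j _ hij => Finset.pairwise_disjoint_powersetCard V hij]
    simp [hV]
  rw [← hcard, ← congrArg (genSperner · 2) hV]
  refine card_le_genSperner_two (by simp [V]) ?_
  rintro ⟨A, B, hAB, hBA, hA, hB, hinf, hsup⟩
  have hinf_left := Finset.card_lt_card (lt_of_le_of_ne inf_le_left (inf_eq_left.not.2 hAB))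
  have hinf_right := Finset.card_lt_card (lt_of_le_of_ne inf_le_right (inf_eq_right.not.2 hBA))
  have hadd : (A ⊔ B).card + (A ⊓ B).card = A.card + B.card := Finset.card_union_add_card_inter A B
  simp only [Finset.mem_coe, Finset.mem_biUnion, Finset.mem_powersetCard_univ, exists_eq_right',
    V] at hA hB hinf hsup
  exact hK _ hA _ hB _ hinf _ hsup hinf_left hinf_right (by omega) (by omega) (by omega)

theorem genSperner_zero_two : genSperner 0 2 = 1 :=
  le_antisymm (genSperner_two_le fun F _ => F.card_le_univ)
    (sum_choose_le_genSperner_two 0 {0} (by decide))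

theorem genSperner_one_two : genSperner 1 2 = 2 :=
  le_antisymm (genSperner_two_succ_le_add_choose 0)
    (sum_choose_le_genSperner_two 1 {0, 1} (by decide))

theorem genSperner_two_two : genSperner 2 2 = 3 :=
  le_antisymm (genSperner_two_succ_le_add_choose 1)
    (sum_choose_le_genSperner_two 2 {0, 1} (by decide))

theorem genSperner_three_two : genSperner 3 2 = 6 :=
  le_antisymm (genSperner_two_succ_le_add_choose 2)
    (sum_choose_le_genSperner_two 3 {1, 2} (by decide))

theorem genSperner_four_two : genSperner 4 2 = 11 :=
  le_antisymm (genSperner_two_succ_le_add_choose 3)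
    (sum_choose_le_genSperner_two 4 {1, 2, 4} (by decide))

theorem genSperner_five_two : genSperner 5 2 = 21 :=
  le_antisymm (Nat.le_of_lt_succ (genSperner_two_mul_add_one_lt (k := 2) le_rfl))
    (sum_choose_le_genSperner_two 5 {0, 2, 3} (by decide))

theorem genSperner_two_succ_lt_two_mul :
    genSperner 6 2 < 2 * genSperner 5 2 ∨ genSperner 7 2 < 2 * genSperner 6 2 := by
  have hseven : genSperner 7 2 < 84 := genSperner_two_mul_add_one_lt (k := 3) (by norm_num)
  have hfive := genSperner_five_two
  omega

end Values

section MaxAvoid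

variable {𝒜 : Set (Set ℕ)} {A X : Finset ℕ}

theorem card_le_maxAvoid (hAX : A ⊆ X) (hA : Avoids 𝒜 A) : A.card ≤ maxAvoid 𝒜 X := by
  classical
  exact Finset.le_sup (f := Finset.card) (by simp [hAX, hA])

theorem exists_card_eq_maxAvoid (h𝒜 : ∅ ∉ 𝒜) (X : Finset ℕ) :
    ∃ A ⊆ X, Avoids 𝒜 A ∧ A.card = maxAvoid 𝒜 X := by
  classical
  have hempty : Avoids 𝒜 ∅ := fun B hB hsub => by
    rw [Finset.coe_empty, Set.subset_empty_iff] at hsub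
    exact h𝒜 (hsub ▸ hB)
  obtain ⟨A, hA, hcard⟩ := Finset.exists_mem_eq_sup (X.powerset.filter (Avoids 𝒜))
    ⟨∅, by simpa using hempty⟩ Finset.card
  simp only [Finset.mem_filter, Finset.mem_powerset] at hA
  refine ⟨A, hA.1, hA.2, ?_⟩
  unfold maxAvoid
  convert hcard.symm

theorem empty_notMem_geometricSquares : ∅ ∉ geometricSquares := by
  rintro ⟨a, r, s, -, -, -, h⟩
  exact (Set.insert_nonempty a _).ne_empty h.symm

theorem avoids_geometricSquares_iff : Avoids geometricSquares A ↔ ∀ a r s, 0 < a → 1 < r → 1 < s →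
    r ≠ s → a ∈ A → a * r ∈ A → a * s ∈ A → a * r * s ∉ A := by
  constructor
  · intro hA a r s ha hr hs hrs h₁ h₂ h₃ h₄
    rcases hrs.lt_or_gt with hlt | hlt
    · exact hA _ ⟨a, r, s, ha, hr, hlt, rfl⟩ (by simp [Set.insert_subset_iff, *])
    · rw [mul_right_comm] at h₄
      exact hA _ ⟨a, s, r, ha, hs, hlt, rfl⟩ (by simp [Set.insert_subset_iff, *])
  · rintro hA _ ⟨a, r, s, ha, hr, hrs, rfl⟩ hsub
    simp only [Set.insert_subset_iff, Set.singleton_subset_iff, Finset.mem_coe] at hsub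
    exact hA a r s ha hr (hr.trans hrs) hrs.ne hsub.1 hsub.2.1 hsub.2.2.1 hsub.2.2.2

theorem Avoids.mul_lcm_notMem (hA : Avoids geometricSquares A) {x u v : ℕ} (hx : 0 < x)
    (huv : ¬ u ∣ v) (hvu : ¬ v ∣ u) (hgcd : x * u.gcd v ∈ A) (hu : x * u ∈ A) (hv : x * v ∈ A) :
    x * u.lcm v ∉ A := by
  obtain ⟨r, s, hrs, hr, hs⟩ := Nat.exists_coprime u v
  have hg : 0 < u.gcd v :=
    Nat.gcd_pos_of_pos_left v (Nat.pos_of_ne_zero fun h => hvu (h ▸ v.dvd_zero))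
  have hlcm : u.lcm v = u.gcd v * r * s := by
    apply Nat.eq_of_mul_eq_mul_left hg
    rw [Nat.gcd_mul_lcm]
    calc u * v = (r * u.gcd v) * (s * u.gcd v) := by rw [← hr, ← hs]
      _ = u.gcd v * (u.gcd v * r * s) := by ring
  have hr1 : r ≠ 1 := fun h => huv (by rw [hr, h, one_mul]; exact Nat.gcd_dvd_right u v)
  have hs1 : s ≠ 1 := fun h => hvu (by rw [hs, h, one_mul]; exact Nat.gcd_dvd_left u v)
  have hr0 : r ≠ 0 := fun h => hvu (by rw [hr, h, zero_mul]; exact v.dvd_zero)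
  have hs0 : s ≠ 0 := fun h => huv (by rw [hs, h, zero_mul]; exact u.dvd_zero)
  have hne : r ≠ s := fun h => hr1 ((Nat.coprime_self r).1 (by simpa [← h] using hrs))
  rw [hlcm, ← mul_assoc, ← mul_assoc]
  refine avoids_geometricSquares_iff.1 hA _ r s (Nat.mul_pos hx hg) (by omega) (by omega) hne hgcd
    ?_ ?_
  · rwa [mul_assoc, mul_comm _ r, ← hr]
  · rwa [mul_assoc, mul_comm _ s, ← hs]

end MaxAvoid

section SquarefreeDivisors

variable {P : ℕ} {A : Finset ℕ} {F : Finset (Finset ℕ)}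

theorem primeFactors_lcm {m n : ℕ} (hm : m ≠ 0) (hn : n ≠ 0) :
    (m.lcm n).primeFactors = m.primeFactors ∪ n.primeFactors := by
  ext p
  simp only [Nat.mem_primeFactors, Finset.mem_union, ne_eq, Nat.lcm_eq_zero_iff, hm, hn, or_self,
    not_false_eq_true, and_true, ← and_or_left]
  exact and_congr_right fun hp => hp.prime.dvd_lcm

theorem primeFactors_injOn_divisors (hP : Squarefree P) :
    (P.divisors : Set ℕ).InjOn Nat.primeFactors := by
  intro t ht u hu h
  rw [← Nat.prod_primeFactors_of_squarefree (hP.squarefree_of_dvd (Nat.dvd_of_mem_divisors ht)),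
    ← Nat.prod_primeFactors_of_squarefree (hP.squarefree_of_dvd (Nat.dvd_of_mem_divisors hu)), h]

theorem not_hasDiamond_primeFactors_of_avoids (hA : Avoids geometricSquares A) (hP : Squarefree P)
    {x : ℕ} (hx : 0 < x) :
    ¬ HasDiamond (Nat.primeFactors '' {t | t ∈ P.divisors ∧ x * t ∈ A}) := by
  rintro ⟨_, _, huv, hvu, ⟨u, ⟨hu, hxu⟩, rfl⟩, ⟨v, ⟨hv, hxv⟩, rfl⟩, ⟨g, ⟨hg, hxg⟩, hginf⟩,
    ⟨l, ⟨hl, hxl⟩, hlsup⟩⟩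
  have hu0 := (Nat.pos_of_mem_divisors hu).ne'
  have hv0 := (Nat.pos_of_mem_divisors hv).ne'
  have hg_eq : g = u.gcd v := primeFactors_injOn_divisors hP hg
    (Nat.mem_divisors.2 ⟨(Nat.gcd_dvd_left u v).trans (Nat.dvd_of_mem_divisors hu), hP.ne_zero⟩)
    (by rw [hginf, Nat.primeFactors_gcd hu0 hv0, Finset.inf_eq_inter])
  have hl_eq : l = u.lcm v := primeFactors_injOn_divisors hP hl
    (Nat.mem_divisors.2 ⟨Nat.lcm_dvd (Nat.dvd_of_mem_divisors hu) (Nat.dvd_of_mem_divisors hv),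
      hP.ne_zero⟩)
    (by rw [hlsup, primeFactors_lcm hu0 hv0, Finset.sup_eq_union])
  exact hA.mul_lcm_notMem hx (mt (Nat.primeFactors_mono · hv0) huv)
    (mt (Nat.primeFactors_mono · hu0) hvu) (hg_eq ▸ hxg) hxu hxv (hl_eq ▸ hxl)

theorem card_filter_divisors_le (hA : Avoids geometricSquares A) (hP : Squarefree P) {x : ℕ}
    (hx : 0 < x) :
    (P.divisors.filter fun t => x * t ∈ A).card ≤ genSperner P.primeFactors.card 2 := by
  have hinj := (primeFactors_injOn_divisors hP).mono
    (Finset.coe_subset.2 (Finset.filter_subset (fun t => x * t ∈ A) _))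
  rw [← Finset.card_image_of_injOn hinj]
  refine card_le_genSperner_two (Finset.image_subset_iff.2 fun t ht => ?_) ?_
  · exact Finset.mem_powerset.2
      (Nat.primeFactors_mono (Nat.dvd_of_mem_divisors (Finset.mem_filter.1 ht).1) hP.ne_zero)
  · rw [Finset.coe_image, Finset.coe_filter]
    exact not_hasDiamond_primeFactors_of_avoids hA hP hx

theorem avoids_filter_divisors (hP : Squarefree P) (hF : ¬ HasDiamond (F : Set (Finset ℕ))) :
    Avoids geometricSquares (P.divisors.filter fun t => t.primeFactors ∈ F) := by
  rw [avoids_geometricSquares_iff]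
  intro a r s _ hr hs _ ha har has hars
  simp only [Finset.mem_filter, Nat.mem_divisors] at ha har has hars
  obtain ⟨⟨hars, -⟩, hsup⟩ := hars
  have hars0 : a * r * s ≠ 0 := ne_zero_of_dvd_ne_zero hP.ne_zero hars
  simp only [ne_eq, mul_eq_zero, not_or] at hars0
  obtain ⟨⟨ha0, hr0⟩, hs0⟩ := hars0
  have hrs : r.Coprime s := Nat.coprime_of_squarefree_mul
    (hP.squarefree_of_dvd ((Dvd.intro_left a (mul_assoc a r s).symm).trans hars))
  have hinf_eq : (a * r).primeFactors ∩ (a * s).primeFactors = a.primeFactors := by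
    rw [← Nat.primeFactors_gcd (mul_ne_zero ha0 hr0) (mul_ne_zero ha0 hs0), Nat.gcd_mul_left,
      hrs.gcd_eq_one, mul_one]
  have hsup_eq : (a * r).primeFactors ∪ (a * s).primeFactors = (a * r * s).primeFactors := by
    rw [Nat.primeFactors_mul ha0 hr0, Nat.primeFactors_mul ha0 hs0,
      Nat.primeFactors_mul (mul_ne_zero ha0 hr0) hs0, Nat.primeFactors_mul ha0 hr0,
      ← Finset.union_union_distrib_left, Finset.union_assoc]
  refine hF ⟨_, _, fun h => ?_, fun h => ?_, har.2, has.2, ?_, ?_⟩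
  · have hself : a = a * r := primeFactors_injOn_divisors hP (Nat.mem_divisors.2 ha.1)
      (Nat.mem_divisors.2 har.1) (by rw [← hinf_eq, Finset.inter_eq_left.2 h])
    exact hr.ne' (Nat.eq_of_mul_eq_mul_left (Nat.pos_of_ne_zero ha0) (by omega))
  · have hself : a = a * s := primeFactors_injOn_divisors hP (Nat.mem_divisors.2 ha.1)
      (Nat.mem_divisors.2 has.1) (by rw [← hinf_eq, Finset.inter_eq_right.2 h])
    exact hs.ne' (Nat.eq_of_mul_eq_mul_left (Nat.pos_of_ne_zero ha0) (by omega))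
  · rw [Finset.inf_eq_inter, hinf_eq]
    exact ha.2
  · rw [Finset.sup_eq_union, hsup_eq]
    exact hsup

theorem card_le_card_filter_divisors (hP : Squarefree P) (hF : F ⊆ P.primeFactors.powerset) :
    F.card ≤ (P.divisors.filter fun t => t.primeFactors ∈ F).card := by
  refine Finset.card_le_card_of_surjOn Nat.primeFactors fun S hS => ?_
  have hSP := Finset.mem_powerset.1 (hF hS)
  have hS_eq := Nat.primeFactors_prod fun p hp => Nat.prime_of_mem_primeFactors (hSP hp)
  refine ⟨∏ p ∈ S, p, ?_, hS_eq⟩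
  simp only [Finset.coe_filter, Set.mem_ofPred_eq, Nat.mem_divisors, hS_eq]
  refine ⟨⟨?_, hP.ne_zero⟩, hS⟩
  rw [← Nat.prod_primeFactors_of_squarefree hP]
  exact Finset.prod_dvd_prod_of_subset _ _ _ hSP

theorem maxAvoid_divisors_of_squarefree (hP : Squarefree P) :
    maxAvoid geometricSquares P.divisors = genSperner P.primeFactors.card 2 := by
  apply le_antisymm
  · obtain ⟨A, hAP, hA, hcard⟩ := exists_card_eq_maxAvoid empty_notMem_geometricSquares P.divisors
    have hfilter : P.divisors.filter (fun t => 1 * t ∈ A) = A := by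
      simp only [one_mul, Finset.filter_mem_eq_inter, Finset.inter_eq_right.2 hAP]
    rw [← hcard, ← hfilter]
    exact card_filter_divisors_le hA hP one_pos
  · obtain ⟨F, hFP, hF, hcard⟩ := exists_card_eq_genSperner_two P.primeFactors
    rw [← hcard]
    exact (card_le_card_filter_divisors hP hFP).trans
      (card_le_maxAvoid (Finset.filter_subset _ _) (avoids_filter_divisors hP hF))

end SquarefreeDivisors

section Primorial

theorem primorialFirst_zero : primorialFirst 0 = 1 := by simp [primorialFirst]

theorem primorialFirst_succ (d : ℕ) :
    primorialFirst (d + 1) = primorialFirst d * Nat.nth Nat.Prime d := by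
  simp [primorialFirst, Fin.prod_univ_castSucc]

theorem coprime_primorialFirst_nth_prime (d : ℕ) :
    (primorialFirst d).Coprime (Nat.nth Nat.Prime d) := by
  refine Nat.Coprime.prod_left fun i _ => ?_
  rw [Nat.coprime_primes (Nat.prime_nth_prime _) (Nat.prime_nth_prime _)]
  exact (Nat.nth_injective Nat.infinite_setOfPred_prime).ne i.2.ne

theorem squarefree_primorialFirst (d : ℕ) : Squarefree (primorialFirst d) := by
  induction d with
  | zero => simp [primorialFirst_zero]
  | succ d ih =>
    rw [primorialFirst_succ, Nat.squarefree_mul (coprime_primorialFirst_nth_prime d)]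
    exact ⟨ih, (Nat.prime_nth_prime d).squarefree⟩

theorem card_primeFactors_primorialFirst (d : ℕ) : (primorialFirst d).primeFactors.card = d := by
  induction d with
  | zero => simp [primorialFirst_zero]
  | succ d ih =>
    rw [primorialFirst_succ, (coprime_primorialFirst_nth_prime d).primeFactors_mul,
      Finset.card_union_of_disjoint (coprime_primorialFirst_nth_prime d).disjoint_primeFactors, ih,
      (Nat.prime_nth_prime d).primeFactors, Finset.card_singleton]

open scoped Pointwise in
theorem primeCube_eq_divisors (d : ℕ) : primeCube d = (primorialFirst d).divisors := by
  ext n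
  have mem_divisors_iff : n ∈ (primorialFirst d).divisors ↔
      ∃ g : Fin d → ℕ, (∀ i : Fin d, g i ∈ (Nat.nth Nat.Prime i).divisors) ∧ ∏ i, g i = n := by
    rw [← Finset.mem_coe, primorialFirst, Finset.nat_divisors_prod, Finset.coe_prod,
      Set.mem_fintype_prod]
    simp
  rw [mem_divisors_iff]
  simp only [primeCube, Finset.mem_image, Finset.mem_univ, true_and,
    (Nat.prime_nth_prime _).divisors, Finset.mem_insert, Finset.mem_singleton]
  constructor
  · rintro ⟨e, rfl⟩
    refine ⟨_, fun i : Fin d => ?_, rfl⟩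
    rcases Fin.exists_fin_two.1 ⟨e i, rfl⟩ with h | h <;> simp [h]
  · rintro ⟨g, hg, rfl⟩
    refine ⟨fun i : Fin d => if g i = 1 then 0 else 1, Finset.prod_congr rfl fun i _ => ?_⟩
    rcases hg i with h | h <;> simp [h, (Nat.prime_nth_prime i).ne_one]

theorem maxAvoid_primeCube (d : ℕ) :
    maxAvoid geometricSquares (primeCube d) = genSperner d 2 := by
  rw [primeCube_eq_divisors, maxAvoid_divisors_of_squarefree (squarefree_primorialFirst d),
    card_primeFactors_primorialFirst]

end Primorial

section CubeBases

variable {P p x : ℕ}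

/-- The points `x` at which the dilate `x * P.divisors` is used in the density estimate: powers of
`4` times numbers coprime to `P`. Powers of `4` are allowed because they raise the density of these
points by a factor `4 / 3` when `P` is even. -/
def IsCubeBase (P x : ℕ) : Prop :=
  ∃ j b : ℕ, b.Coprime P ∧ x = 4 ^ j * b

theorem isCubeBase_one (x : ℕ) : IsCubeBase 1 x :=
  ⟨0, x, Nat.coprime_one_right x, by simp⟩

theorem IsCubeBase.of_mul (h : IsCubeBase (P * p) x) : IsCubeBase P x := by
  obtain ⟨j, b, hb, rfl⟩ := h
  exact ⟨j, b, hb.coprime_mul_right_right, rfl⟩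

theorem IsCubeBase.mul_right (hPp : P.Coprime p) (h : IsCubeBase (P * p) x) :
    IsCubeBase P (x * p) := by
  obtain ⟨j, b, hb, rfl⟩ := h
  exact ⟨j, b * p, hb.coprime_mul_right_right.mul_left hPp.symm, mul_assoc _ _ _⟩

theorem IsCubeBase.four_mul (h : IsCubeBase P x) : IsCubeBase P (4 * x) := by
  obtain ⟨j, b, hb, rfl⟩ := h
  exact ⟨j + 1, b, hb, by ring⟩

theorem isCubeBase_of_coprime (h : x.Coprime P) : IsCubeBase P x :=
  ⟨0, x, h, by simp⟩

theorem IsCubeBase.even_factorization (hp : p.Prime) (h : IsCubeBase (P * p) x) :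
    Even (x.factorization p) := by
  obtain ⟨j, b, hb, rfl⟩ := h
  have hbp : b.factorization p = 0 := Nat.factorization_eq_zero_of_not_dvd
    (hp.coprime_iff_not_dvd.1 hb.coprime_mul_left_right.symm)
  rcases eq_or_ne b 0 with rfl | hb0
  · simp
  rw [Nat.factorization_mul (by positivity) hb0, Finsupp.add_apply, hbp, add_zero,
    show 4 ^ j = (2 ^ j) ^ 2 by rw [pow_right_comm]; norm_num, Nat.factorization_pow,
    Finsupp.smul_apply, smul_eq_mul]
  exact even_two_mul _

theorem IsCubeBase.not_isCubeBase_mul (hp : p.Prime) (h : IsCubeBase (P * p) x) (hx : x ≠ 0) :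
    ¬ IsCubeBase (P * p) (x * p) := by
  intro h'
  have heven := h'.even_factorization hp
  rw [Nat.factorization_mul hx hp.ne_zero, Finsupp.add_apply, hp.factorization_self,
    Nat.even_add_one] at heven
  exact heven (h.even_factorization hp)

open Classical in
/-- The bases for the dilates of `P.divisors` that are at most `N`. -/
noncomputable def cubeBases (P N : ℕ) : Finset ℕ :=
  (Finset.Icc 1 N).filter (IsCubeBase P)

theorem mem_cubeBases {N : ℕ} : x ∈ cubeBases P N ↔ (0 < x ∧ x ≤ N) ∧ IsCubeBase P x := by
  simp [cubeBases, Nat.succ_le_iff]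

theorem cubeBases_one (N : ℕ) : cubeBases 1 N = Finset.Icc 1 N := by
  ext x
  simp [mem_cubeBases, isCubeBase_one, Nat.succ_le_iff]

theorem sum_cubeBases_mul_prime_le (hp : p.Prime) (hPp : P.Coprime p) (N : ℕ) {f : ℕ → ℝ}
    (hf : ∀ x, 0 < x → 0 ≤ f x) :
    ∑ x ∈ cubeBases (P * p) (N / p), (f x + f (x * p)) ≤ ∑ x ∈ cubeBases P N, f x := by
  have hinj : Function.Injective (· * p) := mul_left_injective₀ hp.ne_zero
  have hdisj :
      Disjoint (cubeBases (P * p) (N / p)) ((cubeBases (P * p) (N / p)).image (· * p)) := by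
    rw [Finset.disjoint_right]
    intro y hy hy'
    obtain ⟨x, hx, rfl⟩ := Finset.mem_image.1 hy
    rw [mem_cubeBases] at hx hy'
    exact hx.2.not_isCubeBase_mul hp hx.1.1.ne' hy'.2
  rw [Finset.sum_add_distrib, ← Finset.sum_image (g := (· * p)) hinj.injOn,
    ← Finset.sum_union hdisj]
  refine Finset.sum_le_sum_of_subset_of_nonneg (Finset.union_subset ?_ ?_)
    fun x hx _ => hf x (mem_cubeBases.1 hx).1.1
  · intro x hx
    rw [mem_cubeBases] at hx ⊢
    exact ⟨⟨hx.1.1, hx.1.2.trans (Nat.div_le_self N p)⟩, hx.2.of_mul⟩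
  · refine Finset.image_subset_iff.2 fun x hx => ?_
    rw [mem_cubeBases] at hx ⊢
    exact ⟨⟨Nat.mul_pos hx.1.1 hp.pos, (Nat.le_div_iff_mul_le hp.pos).1 hx.1.2⟩,
      hx.2.mul_right hPp⟩

end CubeBases

section CubeSlack

variable {A : Finset ℕ} {P p : ℕ}

theorem card_filter_divisors_mul_prime (hp : p.Prime) (hPp : P.Coprime p) (A : Finset ℕ) (x : ℕ) :
    ((P * p).divisors.filter fun t => x * t ∈ A).card =
      (P.divisors.filter fun t => x * t ∈ A).card +
        (P.divisors.filter fun t => x * p * t ∈ A).card := by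
  simp only [Finset.card_filter]
  rw [Nat.divisors_mul, Finset.mul_def, Finset.sum_image hPp.mul_injOn_divisors,
    Finset.sum_product, ← Finset.sum_add_distrib]
  refine Finset.sum_congr rfl fun t _ => ?_
  rw [hp.sum_divisors, mul_one, add_comm, mul_assoc x p, mul_comm p]

/-- The amount by which the dilate `x * P.divisors` falls short of containing the extremal number
of elements of `A`. -/
noncomputable def cubeSlack (A : Finset ℕ) (P x : ℕ) : ℝ :=
  genSperner P.primeFactors.card 2 - ((P.divisors.filter fun t => x * t ∈ A).card : ℝ)

theorem cubeSlack_nonneg (hA : Avoids geometricSquares A) (hP : Squarefree P) {x : ℕ}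
    (hx : 0 < x) : 0 ≤ cubeSlack A P x :=
  sub_nonneg.2 (by exact_mod_cast card_filter_divisors_le hA hP hx)

theorem sum_cubeSlack_one {n : ℕ} (hAn : A ⊆ Finset.Icc 1 n) :
    ∑ x ∈ Finset.Icc 1 n, cubeSlack A 1 x = n - A.card := by
  have hslack : ∀ x, cubeSlack A 1 x = 1 - if x ∈ A then 1 else 0 := fun x => by
    simp [cubeSlack, genSperner_zero_two, Finset.filter_singleton, apply_ite Finset.card]
  simp [hslack, Finset.sum_ite_mem, Finset.inter_eq_right.2 hAn]

/-- The deficiency `2 c_{d,2,2} - c_{d+1,2,2}`: what is lost when the extremal bounds for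
two `d`-dimensional cubes are replaced by the one for the `d + 1`-dimensional cube they form. -/
noncomputable def spernerDeficiency (d : ℕ) : ℝ :=
  2 * (genSperner d 2 : ℝ) - (genSperner (d + 1) 2 : ℝ)

theorem spernerDeficiency_nonneg (d : ℕ) : 0 ≤ spernerDeficiency d :=
  sub_nonneg.2 (by exact_mod_cast genSperner_two_succ_le_two_mul d)

theorem cubeSlack_add_cubeSlack_mul_prime (hp : p.Prime) (hPp : P.Coprime p) (A : Finset ℕ)
    (x : ℕ) : cubeSlack A P x + cubeSlack A P (x * p) =
      spernerDeficiency P.primeFactors.card + cubeSlack A (P * p) x := by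
  have hω : (P * p).primeFactors.card = P.primeFactors.card + 1 := by
    rw [hPp.primeFactors_mul, Finset.card_union_of_disjoint hPp.disjoint_primeFactors,
      hp.primeFactors, Finset.card_singleton]
  rw [cubeSlack, cubeSlack, cubeSlack, spernerDeficiency, card_filter_divisors_mul_prime hp hPp, hω]
  push_cast
  ring

theorem spernerDeficiency_mul_add_sum_cubeSlack_le (hA : Avoids geometricSquares A) (n d : ℕ) :
    spernerDeficiency d * (cubeBases (primorialFirst (d + 1)) (n / primorialFirst (d + 1))).card +
        ∑ x ∈ cubeBases (primorialFirst (d + 1)) (n / primorialFirst (d + 1)),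
          cubeSlack A (primorialFirst (d + 1)) x ≤
      ∑ x ∈ cubeBases (primorialFirst d) (n / primorialFirst d),
        cubeSlack A (primorialFirst d) x := by
  have hcoprime := coprime_primorialFirst_nth_prime d
  have hprime := Nat.prime_nth_prime d
  calc _ = ∑ x ∈ cubeBases (primorialFirst (d + 1)) (n / primorialFirst (d + 1)),
        (spernerDeficiency d + cubeSlack A (primorialFirst (d + 1)) x) := by
        rw [Finset.sum_add_distrib, Finset.sum_const, nsmul_eq_mul, mul_comm]
    _ = ∑ x ∈ cubeBases (primorialFirst d * Nat.nth Nat.Prime d)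
          (n / primorialFirst d / Nat.nth Nat.Prime d), (cubeSlack A (primorialFirst d) x +
            cubeSlack A (primorialFirst d) (x * Nat.nth Nat.Prime d)) := by
        simp only [cubeSlack_add_cubeSlack_mul_prime hprime hcoprime,
          card_primeFactors_primorialFirst, primorialFirst_succ, Nat.div_div_eq_div_mul]
    _ ≤ _ := sum_cubeBases_mul_prime_le hprime hcoprime _ fun _ hx =>
        cubeSlack_nonneg hA (squarefree_primorialFirst d) hx

theorem sum_spernerDeficiency_mul_le (n D : ℕ) :
    ∑ d ∈ Finset.range D, spernerDeficiency d *
        (cubeBases (primorialFirst (d + 1)) (n / primorialFirst (d + 1))).card ≤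
      n - (maxAvoid geometricSquares (Finset.Icc 1 n) : ℝ) := by
  obtain ⟨A, hAn, hA, hcard⟩ :=
    exists_card_eq_maxAvoid empty_notMem_geometricSquares (Finset.Icc 1 n)
  set slack : ℕ → ℝ := fun d => ∑ x ∈ cubeBases (primorialFirst d) (n / primorialFirst d),
    cubeSlack A (primorialFirst d) x
  have hslack_zero : slack 0 = n - A.card := by
    simp only [slack, primorialFirst_zero, Nat.div_one, cubeBases_one, sum_cubeSlack_one hAn]
  have hslack_nonneg : 0 ≤ slack D := Finset.sum_nonneg fun x hx =>
    cubeSlack_nonneg hA (squarefree_primorialFirst D) (mem_cubeBases.1 hx).1.1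
  calc _ ≤ ∑ d ∈ Finset.range D, (slack d - slack (d + 1)) := Finset.sum_le_sum fun d _ =>
        le_sub_iff_add_le.2 (spernerDeficiency_mul_add_sum_cubeSlack_le hA n d)
    _ = slack 0 - slack D := Finset.sum_range_sub' slack D
    _ ≤ _ := by rw [hslack_zero, hcard]; linarith

end CubeSlack

section CountingBases

variable {P : ℕ}

theorem card_filter_coprime_Ico (P k : ℕ) :
    ((Finset.Ico 1 (1 + k * P)).filter P.Coprime).card = k * P.totient := by
  induction k with
  | zero => simp
  | succ k ih =>
    rw [add_mul, one_mul, ← add_assoc, ← Finset.Ico_union_Ico_eq_Ico (Nat.le_add_right _ _)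
      (Nat.le_add_right (1 + k * P) P), Finset.filter_union, Finset.card_union_of_disjoint
      (Finset.disjoint_filter_filter (Finset.Ico_disjoint_Ico_consecutive _ _ _)), ih,
      Nat.filter_coprime_Ico_eq_totient, add_mul, one_mul]

theorem totient_mul_div_sub_le_card_filter_coprime (hP : 0 < P) (N : ℕ) :
    (P.totient / P : ℝ) * N - P.totient ≤ ((Finset.Icc 1 N).filter P.Coprime).card := by
  have hsub : Finset.Ico 1 (1 + N / P * P) ⊆ Finset.Icc 1 N := fun x hx => by
    have := Nat.div_mul_le_self N P
    simp only [Finset.mem_Ico, Finset.mem_Icc] at hx ⊢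
    omega
  have hcard := (card_filter_coprime_Ico P (N / P)).symm.trans_le
    (Finset.card_le_card (Finset.filter_subset_filter P.Coprime hsub))
  have hdiv : (N / P : ℝ) ≤ (N / P : ℕ) + 1 := by
    rw [← Nat.floor_div_eq_div (K := ℝ)]
    exact (Nat.lt_floor_add_one _).le
  calc (P.totient / P : ℝ) * N - P.totient = (N / P - 1) * P.totient := by ring
    _ ≤ (N / P : ℕ) * P.totient := by gcongr; linarith
    _ ≤ _ := by exact_mod_cast hcard

theorem card_filter_coprime_add_card_cubeBases_le (hP : Even P) (N : ℕ) :
    ((Finset.Icc 1 N).filter P.Coprime).card + (cubeBases P (N / 4)).card ≤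
      (cubeBases P N).card := by
  have hinj : Function.Injective (4 * ·) := mul_right_injective₀ four_ne_zero
  rw [← Finset.card_image_of_injective (cubeBases P (N / 4)) hinj,
    ← Finset.card_union_of_disjoint]
  · refine Finset.card_le_card (Finset.union_subset (fun x hx => ?_)
      (Finset.image_subset_iff.2 fun x hx => ?_))
    · simp only [Finset.mem_filter, Finset.mem_Icc] at hx
      exact mem_cubeBases.2 ⟨hx.1, isCubeBase_of_coprime hx.2.symm⟩
    · rw [mem_cubeBases] at hx ⊢
      exact ⟨by omega, hx.2.four_mul⟩
  · rw [Finset.disjoint_right]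
    intro y hy hy'
    obtain ⟨x, -, rfl⟩ := Finset.mem_image.1 hy
    have hodd := Nat.Coprime.coprime_dvd_left hP.two_dvd (Finset.mem_filter.1 hy').2
    exact absurd (Nat.Coprime.eq_one_of_dvd hodd (by omega)) (by norm_num)

theorem exists_totient_mul_geom_sum_sub_le_card_cubeBases (hP : Even P) (hP0 : 0 < P) (J : ℕ) :
    ∃ C : ℝ, ∀ N : ℕ, (P.totient / P : ℝ) * (∑ j ∈ Finset.range J, (1 / 4 : ℝ) ^ j) * N - C ≤
      (cubeBases P N).card := by
  induction J with
  | zero => exact ⟨0, by simp⟩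
  | succ J ih =>
    obtain ⟨C, hC⟩ := ih
    set κ : ℝ := P.totient / P * ∑ j ∈ Finset.range J, (1 / 4 : ℝ) ^ j
    refine ⟨P.totient + κ + C, fun N => ?_⟩
    have hcoprime := totient_mul_div_sub_le_card_filter_coprime hP0 N
    have hrec : (((Finset.Icc 1 N).filter P.Coprime).card : ℝ) + (cubeBases P (N / 4)).card ≤
        (cubeBases P N).card := by
      exact_mod_cast card_filter_coprime_add_card_cubeBases_le hP N
    have hdiv : (N / 4 - 1 : ℝ) ≤ (N / 4 : ℕ) := by
      have : N ≤ 4 * (N / 4) + 4 := by omega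
      have : (N : ℝ) ≤ 4 * (N / 4 : ℕ) + 4 := by exact_mod_cast this
      linarith
    have hκ : κ * (N / 4 - 1) ≤ κ * (N / 4 : ℕ) := by gcongr
    calc _ = (P.totient / P : ℝ) * N - P.totient + (κ * (N / 4 - 1) - C) := by
          rw [geom_sum_succ]; ring
      _ ≤ _ := by linarith [hC (N / 4)]

end CountingBases

section UpperDensity

theorem limsup_div_le_of_forall_le_mul_add {f : ℕ → ℝ} {L C : ℝ} (hf : ∀ n, 0 ≤ f n)
    (h : ∀ n : ℕ, f n ≤ L * n + C) : limsup (fun n : ℕ => f n / n) atTop ≤ L := by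
  have hlim : Tendsto (fun n : ℕ => L + C / (n : ℝ)) atTop (nhds L) := by
    simpa using tendsto_const_nhds.add (tendsto_const_div_atTop_nhds_zero_nat C)
  have hbdd : IsBoundedUnder (· ≥ ·) atTop fun n : ℕ => f n / n :=
    isBoundedUnder_of ⟨0, fun n => div_nonneg (hf n) n.cast_nonneg⟩
  rw [← hlim.limsup_eq]
  refine limsup_le_limsup ?_ hbdd.isCoboundedUnder_le hlim.isBoundedUnder_le
  filter_upwards [eventually_gt_atTop 0] with n hn
  have hn' : (0 : ℝ) < n := by exact_mod_cast hn
  rw [div_le_iff₀ hn', add_mul, div_mul_cancel₀ _ hn'.ne']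
  exact h n

/-- The upper density of the largest subsets of `[n]` that avoid `𝒜`. -/
noncomputable def avoidanceDensity (𝒜 : Set (Set ℕ)) : ℝ :=
  limsup (fun n : ℕ => (maxAvoid 𝒜 (Finset.Icc 1 n) : ℝ) / (n : ℝ)) atTop

theorem maxAvoid_le_card (𝒜 : Set (Set ℕ)) (X : Finset ℕ) : maxAvoid 𝒜 X ≤ X.card := by
  classical
  exact Finset.sup_le fun A hA =>
    Finset.card_le_card (Finset.mem_powerset.1 (Finset.mem_filter.1 hA).1)

theorem le_avoidanceDensity {𝒜 : Set (Set ℕ)} {c : ℝ}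
    (h : ∀ n : ℕ, c * n ≤ maxAvoid 𝒜 (Finset.Icc 1 n)) : c ≤ avoidanceDensity 𝒜 := by
  have hbdd : IsBoundedUnder (· ≤ ·) atTop
      fun n : ℕ => (maxAvoid 𝒜 (Finset.Icc 1 n) : ℝ) / (n : ℝ) :=
    isBoundedUnder_of ⟨1, fun n => div_le_one_of_le₀
      (by exact_mod_cast (maxAvoid_le_card 𝒜 (Finset.Icc 1 n)).trans_eq (Nat.card_Icc 1 n))
      n.cast_nonneg⟩
  refine le_limsup_of_frequently_le (Eventually.frequently ?_) hbdd
  filter_upwards [eventually_gt_atTop 0] with n hn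
  exact (le_div_iff₀ (by exact_mod_cast hn)).2 (h n)

theorem avoids_Ioc_div_six (n : ℕ) : Avoids geometricSquares (Finset.Ioc (n / 6) n) := by
  rw [avoids_geometricSquares_iff]
  intro a r s _ hr hs hrs ha _ _ hars
  rw [Finset.mem_Ioc] at ha hars
  have hrs6 : 6 ≤ r * s := by
    rcases hrs.lt_or_gt with h | h
    · exact Nat.mul_le_mul (show 2 ≤ r from hr) (show 3 ≤ s by omega)
    · exact Nat.mul_le_mul (show 3 ≤ r by omega) (show 2 ≤ s from hs)
  have : a * 6 ≤ a * r * s := by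
    rw [mul_assoc]
    exact Nat.mul_le_mul_left a hrs6
  omega

theorem five_sixths_le_avoidanceDensity : 5 / 6 ≤ avoidanceDensity geometricSquares := by
  refine le_avoidanceDensity fun n => ?_
  have hcard := card_le_maxAvoid (X := Finset.Icc 1 n) (fun x hx => by
    simp only [Finset.mem_Ioc, Finset.mem_Icc] at hx ⊢; omega) (avoids_Ioc_div_six n)
  rw [Nat.card_Ioc] at hcard
  have : 5 * n ≤ 6 * maxAvoid geometricSquares (Finset.Icc 1 n) := by omega
  have : (5 : ℝ) * n ≤ 6 * maxAvoid geometricSquares (Finset.Icc 1 n) := by exact_mod_cast this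
  linarith

end UpperDensity

section SpernerSeries

/-- The weight `φ(P_{d+1}) / P_{d+1} ^ 2` of the deficiency `2 c_{d,2,2} - c_{d+1,2,2}` in the
series of the theorem, which is indexed from `0` here. -/
noncomputable def cubeDensity (d : ℕ) : ℝ :=
  (Nat.totient (primorialFirst (d + 1)) : ℝ) / (primorialFirst (d + 1) : ℝ) ^ 2

theorem primorialFirst_pos (d : ℕ) : 0 < primorialFirst d :=
  (squarefree_primorialFirst d).ne_zero.bot_lt

theorem even_primorialFirst_succ (d : ℕ) : Even (primorialFirst (d + 1)) := by
  induction d with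
  | zero => simp [primorialFirst_succ, primorialFirst_zero]
  | succ d ih => exact primorialFirst_succ (d + 1) ▸ ih.mul_right _

theorem cubeDensity_pos (d : ℕ) : 0 < cubeDensity d := by
  have hP := primorialFirst_pos (d + 1)
  unfold cubeDensity
  have := Nat.totient_pos.2 hP
  positivity

theorem spernerDeficiency_mul_cubeDensity_nonneg (d : ℕ) :
    0 ≤ spernerDeficiency d * cubeDensity d :=
  mul_nonneg (spernerDeficiency_nonneg d) (cubeDensity_pos d).le

theorem exists_cubeDensity_mul_geom_sum_sub_le_card_cubeBases (J d : ℕ) : ∃ C : ℝ, ∀ n : ℕ,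
    cubeDensity d * (∑ j ∈ Finset.range J, (1 / 4 : ℝ) ^ j) * n - C ≤
      (cubeBases (primorialFirst (d + 1)) (n / primorialFirst (d + 1))).card := by
  unfold cubeDensity
  set P := primorialFirst (d + 1)
  have hP : 0 < P := primorialFirst_pos (d + 1)
  obtain ⟨C, hC⟩ :=
    exists_totient_mul_geom_sum_sub_le_card_cubeBases (even_primorialFirst_succ d) hP J
  set κ : ℝ := P.totient / P * ∑ j ∈ Finset.range J, (1 / 4 : ℝ) ^ j with hκ_def
  refine ⟨κ + C, fun n => ?_⟩
  have hdiv : (n / P - 1 : ℝ) ≤ (n / P : ℕ) := by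
    rw [← Nat.floor_div_eq_div (K := ℝ)]
    exact (Nat.sub_one_lt_floor _).le
  have hκ : κ * (n / P - 1) ≤ κ * (n / P : ℕ) := by gcongr
  calc _ = κ * (n / P - 1) - C := by rw [hκ_def]; ring
    _ ≤ _ := by linarith [hC (n / P)]

theorem avoidanceDensity_le_one_sub_geom_sum_mul_sum (J D : ℕ) :
    avoidanceDensity geometricSquares ≤ 1 - (∑ j ∈ Finset.range J, (1 / 4 : ℝ) ^ j) *
      ∑ d ∈ Finset.range D, spernerDeficiency d * cubeDensity d := by
  choose C hC using exists_cubeDensity_mul_geom_sum_sub_le_card_cubeBases J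
  refine limsup_div_le_of_forall_le_mul_add
    (C := ∑ d ∈ Finset.range D, spernerDeficiency d * C d) (fun n => Nat.cast_nonneg _) fun n => ?_
  have hsum := calc
    (∑ j ∈ Finset.range J, (1 / 4 : ℝ) ^ j) *
          (∑ d ∈ Finset.range D, spernerDeficiency d * cubeDensity d) * n -
          ∑ d ∈ Finset.range D, spernerDeficiency d * C d
      = ∑ d ∈ Finset.range D, spernerDeficiency d *
          (cubeDensity d * (∑ j ∈ Finset.range J, (1 / 4 : ℝ) ^ j) * n - C d) := by
        rw [Finset.mul_sum, Finset.sum_mul, ← Finset.sum_sub_distrib]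
        exact Finset.sum_congr rfl fun d _ => by ring
    _ ≤ ∑ d ∈ Finset.range D, spernerDeficiency d *
          (cubeBases (primorialFirst (d + 1)) (n / primorialFirst (d + 1))).card :=
        Finset.sum_le_sum fun d _ => mul_le_mul_of_nonneg_left (hC d n) (spernerDeficiency_nonneg d)
    _ ≤ n - (maxAvoid geometricSquares (Finset.Icc 1 n) : ℝ) := sum_spernerDeficiency_mul_le n D
  linarith

theorem summable_spernerDeficiency_mul_cubeDensity :
    Summable fun d => spernerDeficiency d * cubeDensity d := by
  refine summable_of_sum_range_le (c := 1) spernerDeficiency_mul_cubeDensity_nonneg fun D => ?_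
  have hle := avoidanceDensity_le_one_sub_geom_sum_mul_sum 1 D
  rw [Finset.sum_range_one, pow_zero, one_mul] at hle
  linarith [five_sixths_le_avoidanceDensity]

theorem avoidanceDensity_le_one_sub_tsum : avoidanceDensity geometricSquares ≤
    1 - 4 / 3 * ∑' d, spernerDeficiency d * cubeDensity d := by
  have hgeom : Tendsto (fun N => ∑ j ∈ Finset.range N, (1 / 4 : ℝ) ^ j) atTop (nhds (4 / 3)) := by
    rw [show (4 / 3 : ℝ) = (1 - 1 / 4)⁻¹ by norm_num]
    exact (hasSum_geometric_of_lt_one (by norm_num) (by norm_num)).tendsto_sum_nat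
  have hseries := summable_spernerDeficiency_mul_cubeDensity.hasSum.tendsto_sum_nat
  exact ge_of_tendsto' ((hgeom.mul hseries).const_sub 1) fun N =>
    avoidanceDensity_le_one_sub_geom_sum_mul_sum N N

theorem sum_range_five_spernerDeficiency_mul_cubeDensity :
    ∑ d ∈ Finset.range 5, spernerDeficiency d * cubeDensity d =
      1 / 18 + 4 / 3675 + 8 / 88935 := by
  have hP2 : primorialFirst 2 = 6 := by simp [primorialFirst, Fin.prod_univ_succ]
  have hP4 : primorialFirst 4 = 210 := by simp [primorialFirst, Fin.prod_univ_succ]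
  have hP5 : primorialFirst 5 = 2310 := by simp [primorialFirst, Fin.prod_univ_succ]
  have hφ2 : Nat.totient 6 = 2 := by decide
  have hφ4 : Nat.totient 210 = 48 := by decide +kernel
  have hφ5 : Nat.totient 2310 = 480 := by decide +kernel
  simp only [Finset.sum_range_succ, Finset.sum_range_zero, spernerDeficiency, genSperner_zero_two,
    genSperner_one_two, genSperner_two_two, genSperner_three_two, genSperner_four_two,
    genSperner_five_two, cubeDensity, zero_add, Nat.reduceAdd, hP2, hP4, hP5, hφ2, hφ4, hφ5]
  norm_num

theorem exists_spernerDeficiency_pos : ∃ k, 5 ≤ k ∧ 0 < spernerDeficiency k := by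
  simp only [spernerDeficiency, sub_pos]
  rcases genSperner_two_succ_lt_two_mul with h | h
  · exact ⟨5, le_rfl, by exact_mod_cast h⟩
  · exact ⟨6, by norm_num, by exact_mod_cast h⟩

theorem one_sub_tsum_spernerDeficiency_mul_cubeDensity_lt :
    1 - 4 / 3 * ∑' d, spernerDeficiency d * cubeDensity d < 3699337 / 4002075 := by
  obtain ⟨k, hk5, hk⟩ := exists_spernerDeficiency_pos
  have hlt := calc
    ∑ d ∈ Finset.range 5, spernerDeficiency d * cubeDensity d
      < ∑ d ∈ insert k (Finset.range 5), spernerDeficiency d * cubeDensity d := by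
        rw [Finset.sum_insert (by simpa using hk5)]
        exact lt_add_of_pos_left _ (mul_pos hk (cubeDensity_pos k))
    _ ≤ ∑' d, spernerDeficiency d * cubeDensity d :=
        summable_spernerDeficiency_mul_cubeDensity.sum_le_tsum _ fun d _ =>
          spernerDeficiency_mul_cubeDensity_nonneg d
  rw [sum_range_five_spernerDeficiency_mul_cubeDensity] at hlt
  linarith

end SpernerSeries

theorem mainTheorem5 :
    (∀ d : ℕ, maxAvoid geometricSquares (primeCube d) = genSperner d 2) ∧
    (genSperner 0 2 = 1 ∧ genSperner 1 2 = 2 ∧ genSperner 2 2 = 3 ∧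
      genSperner 3 2 = 6 ∧ genSperner 4 2 = 11 ∧ genSperner 5 2 = 21) ∧
    (5 / 6 : ℝ) ≤
      limsup (fun n : ℕ => (maxAvoid geometricSquares (Finset.Icc 1 n) : ℝ) / (n : ℝ)) atTop ∧
    Summable (fun d : ℕ => (2 * (genSperner d 2 : ℝ) - (genSperner (d + 1) 2 : ℝ)) *
      ((Nat.totient (primorialFirst (d + 1)) : ℝ) / (primorialFirst (d + 1) : ℝ) ^ 2)) ∧
    limsup (fun n : ℕ => (maxAvoid geometricSquares (Finset.Icc 1 n) : ℝ) / (n : ℝ)) atTop ≤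
      1 - 4 / 3 * ∑' d : ℕ, (2 * (genSperner d 2 : ℝ) - (genSperner (d + 1) 2 : ℝ)) *
        ((Nat.totient (primorialFirst (d + 1)) : ℝ) / (primorialFirst (d + 1) : ℝ) ^ 2) ∧
    1 - 4 / 3 * ∑' d : ℕ, (2 * (genSperner d 2 : ℝ) - (genSperner (d + 1) 2 : ℝ)) *
        ((Nat.totient (primorialFirst (d + 1)) : ℝ) / (primorialFirst (d + 1) : ℝ) ^ 2) <
      (3699337 / 4002075 : ℝ) :=
  ⟨maxAvoid_primeCube,
    ⟨genSperner_zero_two, genSperner_one_two, genSperner_two_two, genSperner_three_two,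
      genSperner_four_two, genSperner_five_two⟩,
    five_sixths_le_avoidanceDensity,
    summable_spernerDeficiency_mul_cubeDensity,
    avoidanceDensity_le_one_sub_tsum,
    one_sub_tsum_spernerDeficiency_mul_cubeDensity_lt⟩
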